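/- For $k\ge 0$ let $P_k$ be the Legendre polynomial of degree $k$, and let $C_k^{(a)}$, $a\in\{-\tfrac12,-\tfrac32\}$, be the ultraspherical polynomials, given by $C_0^{(a)}(x)=1$, $C_1^{(a)}(x)=2ax$ and $(n+2)C_{n+2}^{(a)}(x)=2(n+1+a)xC_{n+1}^{(a)}(x)-(n+2a)C_n^{(a)}(x)$. Let $\log$ be the principal logarithm, with $\arg\in(-\pi,\pi]$, and $0\log 0=0$. Let $\log_- w=\log|w|-\mathrm i\pi$ if $w$ is a negative real number, and $\log_- w=\log w$ otherwise. Let $\delta$ be the Kronecker delta. For $z=x+\mathrm iy\in\mathbb C$ put $$L_k(z)=\int_{-1}^1\log(z-t)P_k(t)\,dt,\qquad M_k(z)=\int_{-1}^1\log(z-\mathrm it)P_k(t)\,dt,\qquad L_{-1}=M_{-1}=0,$$ $$L_{kj}(z)=\iint_{[-1,1]^2}\log\bigl(z-(s+\mathrm it)\bigr)P_k(s)P_j(t)\,ds\,dt,\qquad L(z)=\bigl(L_{kj}(z)\bigr)_{k,j\ge0},$$ $$\lambda_0(z)=(z-1)\log(z-1)+(z+1)\log(z+1),\quad \lambda_1(z)=-\tfrac23,\quad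 \lambda_k(z)=0\ (k\ge2),$$ $$\mu_k(z)=\delta_{k0}\bigl[(z-\mathrm i)\log(z-\mathrm i)+(z+\mathrm i)\log_-(z+\mathrm i)\bigr]-\tfrac{2\mathrm i}{3}\delta_{k1}-\begin{cases}2\mathrm i\pi x\,C_{k+1}^{(-1/2)}(y)& x<0,\ -1<y<1\\0&\text{otherwise,}\end{cases}$$ $$\beta_{kj}(z)=2\mathrm i\pi\, C_{j+1}^{(-1/2)}(y)\begin{cases}\tfrac13C_{k+2}^{(-3/2)}(x)-\delta_{k0}x+\tfrac13\delta_{k1}& -1\le x\le1,\ -1\le y<1\\-2x\,\delta_{k0}+\tfrac23\delta_{k1}&x<-1,\ -1\le y<1\\0&\text{otherwise.}\end{cases}$$ Define infinite matrices $F^{(1)}(z)$, $F^{(2)}(z)$ (rows $k\ge0$, columns $j\ge0$) by $$F^{(1)}_{0j}(z)=\mathrm i\,\frac{M_{j+1}(z-1)+M_{j+1}(z+1)-M_{j-1}(z-1)-M_{j-1}(z+1)}{2j+1}+\mu_j(z-1)+\mu_j(z+1),$$ $F^{(1)}_{10}(z)=-\tfrac43$, and $F^{(1)}_{kj}(z)=0$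 for all other $(k,j)$; $$F^{(2)}_{k0}(z)=\frac{L_{k+1}(z-\mathrm i)+L_{k+1}(z+\mathrm i)-L_{k-1}(z-\mathrm i)-L_{k-1}(z+\mathrm i)}{2k+1}+\lambda_k(z-\mathrm i)+\lambda_k(z+\mathrm i)+\beta_{k0}(z),$$ $F^{(2)}_{01}(z)=-\tfrac{4\mathrm i}{3}+\beta_{01}(z)$, and $F^{(2)}_{kj}(z)=\beta_{kj}(z)$ for all other $(k,j)$. Let $F(z)=F^{(2)}(z)-F^{(1)}(z)$. Let $A$ and $B$ be the infinite tridiagonal matrices with zero diagonal and with $$A_{k,k-1}=\frac{k-1}{2k+1},\quad A_{k,k+1}=\frac{k+2}{2k+1},\quad B_{k,k-1}=\frac{k}{2k+1},\quad B_{k,k+1}=\frac{k+1}{2k+1},$$ and let $C=A-B$. **Theorem.** The matrix $C$ is tridiagonal with zero diagonal, $C_{k,k-1}=-\frac1{2k+1}$ for $k\ge1$ and $C_{k,k+1}=\frac1{2k+1}$ for $k\ge0$. For every $z\in\mathbb C$ the integrals $L_{kj}(z)$ converge absolutely, the Sylvester equation $$C\,L(z)-\mathrm i\,L(z)\,C^\top=F(z)$$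 holds, and $F(z)$ has rank at most $3$ (the span of its columns has dimension at most $3$). -/

import Mathlib

noncomputable section

namespace LogSquare

open MeasureTheory

/-- The Legendre polynomials `P_k`, as functions on `ℝ`, through their three-term recurrence
`(n + 2) P_{n+2}(x) = (2n + 3) x P_{n+1}(x) - (n + 1) P_n(x)`, `P_0 = 1`, `P_1 = x`. -/
def legendre : ℕ → ℝ → ℝ
  | 0, _ => 1
  | 1, x => x
  | n + 2, x =>
      ((2 * (n : ℝ) + 3) * x * legendre (n + 1) x - ((n : ℝ) + 1) * legendre n x) / ((n : ℝ) + 2)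

/-- The ultraspherical polynomials `C_k^{(a)}`, through their three-term recurrence
`(n + 2) C_{n+2}(x) = 2 (n + 1 + a) x C_{n+1}(x) - (n + 2 a) C_n(x)`, `C_0 = 1`, `C_1 = 2 a x`.
It is valid for every `a ≠ 0`; here it is used for `a = -1/2` and `a = -3/2`. -/
def ultraspherical (a : ℝ) : ℕ → ℝ → ℝ
  | 0, _ => 1
  | 1, x => 2 * a * x
  | n + 2, x =>
      (2 * ((n : ℝ) + 1 + a) * x * ultraspherical a (n + 1) x
        - ((n : ℝ) + 2 * a) * ultraspherical a n x) / ((n : ℝ) + 2)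

/-- `u_{n-1}`, with the convention `u_{-1} = 0`. -/
def prev (u : ℕ → ℂ) : ℕ → ℂ
  | 0 => 0
  | n + 1 => u n

/-! Integrals over the interval -/

/-- `L_k(z) = ∫_{-1}^1 log(z - t) P_k(t) dt`, principal branch with `arg` in `(-π, π]`. -/
def L1 (k : ℕ) (z : ℂ) : ℂ :=
  ∫ t in (-1 : ℝ)..1, Complex.log (z - (t : ℂ)) * (legendre k t : ℂ)

/-- `M_k(z) = ∫_{-1}^1 log(z - i t) P_k(t) dt`. -/
def M1 (k : ℕ) (z : ℂ) : ℂ :=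
  ∫ t in (-1 : ℝ)..1, Complex.log (z - Complex.I * (t : ℂ)) * (legendre k t : ℂ)

/-! Integrals over the square -/

/-- The square `Ω = [-1, 1]²`. -/
def square : Set (ℝ × ℝ) := Set.Icc (-1 : ℝ) 1 ×ˢ Set.Icc (-1 : ℝ) 1

/-- `log(z - (s + i t)) P_k(s) P_j(t)` at `p = (s, t)`. -/
def logIntegrand (k j : ℕ) (z : ℂ) (p : ℝ × ℝ) : ℂ :=
  Complex.log (z - ((p.1 : ℂ) + Complex.I * (p.2 : ℂ)))
    * ((legendre k p.1 : ℂ) * (legendre j p.2 : ℂ))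

/-- The infinite matrix `L(z)`, with entry
`L_{kj}(z) = ∬_Ω log(z - (s + i t)) P_k(s) P_j(t) ds dt` in row `k` and column `j`. -/
def L (z : ℂ) : Matrix ℕ ℕ ℂ :=
  Matrix.of fun k j => ∫ p in square, logIntegrand k j z p

/-! The tridiagonal matrices -/

/-- Subdiagonal `(k - 1)/(2k + 1)`, superdiagonal `(k + 2)/(2k + 1)` in row `k`. -/
def A : Matrix ℕ ℕ ℂ :=
  Matrix.of fun k n =>
    if k = n + 1 then ((k : ℂ) - 1) / (2 * (k : ℂ) + 1)
    else if n = k + 1 then ((k : ℂ) + 2) / (2 * (k : ℂ) + 1)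
    else 0

/-- Subdiagonal `k/(2k + 1)`, superdiagonal `(k + 1)/(2k + 1)` in row `k`. -/
def B : Matrix ℕ ℕ ℂ :=
  Matrix.of fun k n =>
    if k = n + 1 then (k : ℂ) / (2 * (k : ℂ) + 1)
    else if n = k + 1 then ((k : ℂ) + 1) / (2 * (k : ℂ) + 1)
    else 0

def C : Matrix ℕ ℕ ℂ := A - B

/-- The product of infinite matrices. It is only used where one factor is tridiagonal, so that
each of the series has at most three nonzero terms. -/
def infMul (X Y : Matrix ℕ ℕ ℂ) : Matrix ℕ ℕ ℂ :=
  Matrix.of fun k j => ∑' n, X k n * Y n j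

/-! The right-hand side -/

/-- The logarithm with the other limit along its branch cut. -/
def logMinus (z : ℂ) : ℂ :=
  if z.im = 0 ∧ z.re < 0 then (Real.log ‖z‖ : ℂ) - Complex.I * (Real.pi : ℂ) else Complex.log z

/-- The inhomogeneity `λ_k(z)` of the recurrence for `L_k(z)`. -/
def lam (k : ℕ) (z : ℂ) : ℂ :=
  if k = 0 then (z - 1) * Complex.log (z - 1) + (z + 1) * Complex.log (z + 1)
  else if k = 1 then -2 / 3
  else 0

/-- The inhomogeneity `μ_k(z)` of the recurrence for `M_k(z)`. -/
def mu (k : ℕ) (z : ℂ) : ℂ :=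
  (if k = 0 then (z - Complex.I) * Complex.log (z - Complex.I)
      + (z + Complex.I) * logMinus (z + Complex.I)
    else if k = 1 then -(2 * Complex.I) / 3
    else 0)
  - (if z.re < 0 ∧ -1 < z.im ∧ z.im < 1 then
      2 * Complex.I * (Real.pi : ℂ) * (z.re : ℂ) * (ultraspherical (-1 / 2) (k + 1) z.im : ℂ)
    else 0)

/-- The branch-cut contribution `β_{kj}(z)`, `z = x + i y`. The bottom line `y = -1` is included
and the top line `y = 1` is not, in agreement with the principal branch of the logarithm. -/
def beta (k j : ℕ) (z : ℂ) : ℂ :=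
  2 * Complex.I * (Real.pi : ℂ) * (ultraspherical (-1 / 2) (j + 1) z.im : ℂ) *
    (if (-1 ≤ z.re ∧ z.re ≤ 1) ∧ (-1 ≤ z.im ∧ z.im < 1) then
      (ultraspherical (-3 / 2) (k + 2) z.re : ℂ) / 3
        - (if k = 0 then (z.re : ℂ) else 0) + (if k = 1 then 1 / 3 else 0)
    else if z.re < -1 ∧ (-1 ≤ z.im ∧ z.im < 1) then
      -2 * (if k = 0 then (z.re : ℂ) else 0) + (if k = 1 then 2 / 3 else 0)
    else 0)

/-- `F^{(1)}(z)`. -/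
def F1 (z : ℂ) : Matrix ℕ ℕ ℂ :=
  Matrix.of fun k j =>
    if k = 0 then
      Complex.I * (M1 (j + 1) (z - 1) + M1 (j + 1) (z + 1)
          - prev (fun n => M1 n (z - 1)) j - prev (fun n => M1 n (z + 1)) j) / (2 * (j : ℂ) + 1)
        + mu j (z - 1) + mu j (z + 1)
    else if k = 1 ∧ j = 0 then -4 / 3
    else 0

/-- `F^{(2)}(z)`. -/
def F2 (z : ℂ) : Matrix ℕ ℕ ℂ :=
  Matrix.of fun k j =>
    if j = 0 then
      (L1 (k + 1) (z - Complex.I) + L1 (k + 1) (z + Complex.I)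
          - prev (fun n => L1 n (z - Complex.I)) k - prev (fun n => L1 n (z + Complex.I)) k)
          / (2 * (k : ℂ) + 1)
        + lam k (z - Complex.I) + lam k (z + Complex.I) + beta k 0 z
    else if k = 0 ∧ j = 1 then -(4 * Complex.I) / 3 + beta 0 1 z
    else beta k j z

def F (z : ℂ) : Matrix ℕ ℕ ℂ := F2 z - F1 z

end LogSquare

end

noncomputable section

namespace LogSquare

open MeasureTheory

/-! ### Ultraspherical polynomials -/

/-! Row `k` of `C` sends Legendre moments to moments against the primitive `Q_k = (P_{k+1} -
P_{k-1})/(2k+1)` of `P_k` (`legendreInt`; `Q_0 = x`). So `C L` has entries `∬ log(z-s-it) Q_k(s)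
P_j(t)`, and `L Cᵀ` has entries `∬ log(z-s-it) P_k(s) Q_j(t)`. Integrating by parts in `t` in the
first and in `s` in the second moves the derivative onto the logarithm; both leave the moment of
`1/(z-s-it)` against `Q_k Q_j`, with an extra factor `i` in the first, so it cancels in `C L - i L
Cᵀ`.

What survives is explicit. Since `Q_j(±1) = 0` for `j ≥ 1`, boundary terms occur only in column 0
and row 0. Almost every horizontal line misses the cut, but vertical segments with `s > x` can cross
it; this adds `cutJump`, a function of `k` times a function of `j`. The two integrations are
`integral_log_mul_legendreInt_mul_legendre` and `integral_log_mul_legendre_mul_legendreInt`;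
absolute integrability of the Cauchy kernel on the square justifies comparing the two orders of
integration.

In `F`, the `lam` terms cancel the logarithmic and constant parts of `mu`, and the cut part of `mu`
combines with `beta` into `cutJump`. The rank bound follows because every column except the first
lies in the span of `e_0` and one fixed vector. -/

theorem ultraspherical_succ_succ (a : ℝ) (n : ℕ) (x : ℝ) :
    ((n : ℝ) + 2) * ultraspherical a (n + 2) x =
      2 * ((n : ℝ) + 1 + a) * x * ultraspherical a (n + 1) x
        - ((n : ℝ) + 2 * a) * ultraspherical a n x := by
  have h : (n : ℝ) + 2 ≠ 0 := by positivity
  rw [ultraspherical]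
  field_simp

/-- Legendre polynomials are the ultraspherical polynomials with parameter `1/2`. -/
theorem legendre_eq_ultraspherical (x : ℝ) : ∀ n, legendre n x = ultraspherical (1 / 2) n x
  | 0 => rfl
  | 1 => by simp [legendre, ultraspherical]
  | n + 2 => by
    rw [legendre, ultraspherical, legendre_eq_ultraspherical x (n + 1),
      legendre_eq_ultraspherical x n]
    ring

/-- The contiguity relation between the parameters `a` and `a + 1`. -/
theorem ultraspherical_contiguous {a : ℝ} (ha : ∀ n : ℕ, (n : ℝ) + a ≠ 0) (x : ℝ) : ∀ n : ℕ,
    ((n : ℝ) + 2 + a) * ultraspherical a (n + 2) x =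
      a * (ultraspherical (a + 1) (n + 2) x - ultraspherical (a + 1) n x)
  | 0 => by simp [ultraspherical]; ring
  | 1 => by simp [ultraspherical]; ring
  | n + 2 => by
    have h1 := ultraspherical_contiguous ha x n
    have h2 := ultraspherical_contiguous ha x (n + 1)
    have e1 := ultraspherical_succ_succ a (n + 2) x
    have u1 := ultraspherical_succ_succ (a + 1) n x
    have u3 := ultraspherical_succ_succ (a + 1) (n + 2) x
    have n0 : (n : ℝ) + 4 ≠ 0 := by positivity
    have n1 : (n : ℝ) + 2 + a ≠ 0 := by simpa using ha (n + 2)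
    push_cast at *
    -- The factor `n + 4` clears the recurrence for the new term; `n + 2 + a` lets the induction
    -- hypothesis eliminate degree `n + 2`.
    apply mul_left_cancel₀ n0
    apply mul_left_cancel₀ n1
    have e1' : ((n : ℝ) + 4) * ultraspherical a (n + 2 + 2) x =
        2 * ((n : ℝ) + 3 + a) * x * ultraspherical a (n + 3) x
        - ((n : ℝ) + 2 + 2 * a) * ultraspherical a (n + 2) x := by
      linear_combination e1
    have h2' : ((n : ℝ) + 3 + a) * ultraspherical a (n + 3) x =
      a * (ultraspherical (a + 1) (n + 3) x - ultraspherical (a + 1) (n + 1) x) := by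
      linear_combination h2
    linear_combination ((n : ℝ) + 2 + a) * (n + 4 + a) * e1' - a * (n + 2 + a) * u3
      + 2 * x * (n + 2 + a) * (n + 4 + a) * h2' - (n + 2 + 2 * a) * (n + 4 + a) * h1
      + a * (n + 4 + a) * u1

theorem hasDerivAt_ultraspherical {a : ℝ} (ha : ∀ n : ℕ, (n : ℝ) + a ≠ 0) (x : ℝ) : ∀ n : ℕ,
    HasDerivAt (ultraspherical a (n + 1)) (2 * a * ultraspherical (a + 1) n x) x
  | 0 => by
    have h : HasDerivAt (fun x : ℝ => 2 * a * x) (2 * a * 1) x := (hasDerivAt_id x).const_mul _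
    have e : ultraspherical a (0 + 1) = fun x => 2 * a * x := by funext x; simp [ultraspherical]
    rw [e]
    exact h
  | 1 => by
    have h : HasDerivAt (fun x : ℝ => (4 * a * (1 + a) * x ^ 2 - 2 * a) / 2) _ x :=
      (((hasDerivAt_pow 2 x).const_mul (4 * a * (1 + a))).sub_const (2 * a)).div_const 2
    have e : ultraspherical a (1 + 1) = fun x => (4 * a * (1 + a) * x ^ 2 - 2 * a) / 2 := by
      funext x; simp [ultraspherical]; ring
    rw [e]
    refine h.congr_deriv ?_
    simp [ultraspherical]; ring
  | n + 2 => by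
    have h1 := hasDerivAt_ultraspherical ha x (n + 1)
    have h0 := hasDerivAt_ultraspherical ha x n
    have h : HasDerivAt (fun x : ℝ => (2 * ((n : ℝ) + 2 + a) * x * ultraspherical a (n + 1 + 1) x
        - ((n : ℝ) + 1 + 2 * a) * ultraspherical a (n + 1) x) / ((n : ℝ) + 3)) _ x :=
      ((((hasDerivAt_id x).const_mul (2 * ((n : ℝ) + 2 + a))).mul h1).sub
        (h0.const_mul ((n : ℝ) + 1 + 2 * a))).div_const ((n : ℝ) + 3)
    have e : ultraspherical a (n + 2 + 1) = fun x : ℝ =>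
        (2 * ((n : ℝ) + 2 + a) * x * ultraspherical a (n + 1 + 1) x
          - ((n : ℝ) + 1 + 2 * a) * ultraspherical a (n + 1) x) / ((n : ℝ) + 3) := by
      funext x
      rw [show n + 2 + 1 = (n + 1) + 2 from rfl, ultraspherical]
      push_cast
      ring
    rw [e]
    refine h.congr_deriv ?_
    -- Differentiating the recurrence leaves one term with parameter `a`, namely degree `n + 2`;
    -- contiguity converts it to parameter `a + 1`, where the recurrence closes the identity.
    have c := ultraspherical_contiguous ha x n
    have u := ultraspherical_succ_succ (a + 1) n x
    have n0 : (n : ℝ) + 3 ≠ 0 := by positivity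
    rw [div_eq_iff n0]
    simp only [id]
    linear_combination (-2 * a) * u + 2 * c

theorem ne_zero_add_neg_half (n : ℕ) : (n : ℝ) + (-1 / 2) ≠ 0 := by
  intro h
  have : (2 * n : ℝ) = 1 := by linarith
  have : 2 * n = 1 := by exact_mod_cast this
  omega

theorem ne_zero_add_neg_three_half (n : ℕ) : (n : ℝ) + (-3 / 2) ≠ 0 := by
  intro h
  have : (2 * n : ℝ) = 3 := by linarith
  have : 2 * n = 3 := by exact_mod_cast this
  omega

/-- The primitive `(P_{k+1} - P_{k-1}) / (2k + 1)` of the Legendre polynomial `P_k`. -/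
def legendreInt (k : ℕ) (x : ℝ) : ℝ := -ultraspherical (-1 / 2) (k + 1) x

theorem hasDerivAt_legendreInt (k : ℕ) (x : ℝ) :
    HasDerivAt (legendreInt k) (legendre k x) x := by
  have h := (hasDerivAt_ultraspherical ne_zero_add_neg_half x k).neg
  rw [legendre_eq_ultraspherical]
  refine h.congr_deriv ?_
  norm_num

theorem continuous_legendreInt (k : ℕ) : Continuous (legendreInt k) :=
  continuous_iff_continuousAt.2 fun x => (hasDerivAt_legendreInt k x).continuousAt

theorem continuous_legendre : ∀ k, Continuous (legendre k)
  | 0 => continuous_const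
  | 1 => continuous_id.congr fun x => by simp [legendre]
  | n + 2 => by
    have h1 := continuous_legendre (n + 1)
    have h0 := continuous_legendre n
    simp only [legendre]
    fun_prop

theorem legendreInt_zero (x : ℝ) : legendreInt 0 x = x := by
  rw [legendreInt, ultraspherical]
  ring

theorem legendreInt_succ (k : ℕ) (x : ℝ) :
    legendreInt (k + 1) x = (legendre (k + 2) x - legendre k x) / (2 * (k + 1 : ℝ) + 1) := by
  have h := ultraspherical_contiguous ne_zero_add_neg_half x k
  have n0 : 2 * (k + 1 : ℝ) + 1 ≠ 0 := by positivity
  rw [legendreInt, legendre_eq_ultraspherical, legendre_eq_ultraspherical, eq_div_iff n0]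
  rw [show (-1 / 2 + 1 : ℝ) = 1 / 2 by norm_num] at h
  linear_combination (-2) * h

/-- Degrees 2 and 3 are divisible by `1 - x²`, and the recurrence propagates the zeros. This is why
boundary terms occur only at index 0. -/
theorem ultraspherical_neg_half_eq_zero {x : ℝ} (hx : x ^ 2 = 1) : ∀ n,
    ultraspherical (-1 / 2) (n + 2) x = 0
  | 0 => by simp only [ultraspherical]; push_cast; linear_combination -hx / 2
  | 1 => by simp only [ultraspherical]; push_cast; linear_combination -x * hx / 2
  | n + 2 => by
    rw [ultraspherical, ultraspherical_neg_half_eq_zero hx (n + 1),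
      ultraspherical_neg_half_eq_zero hx n]
    simp

theorem legendreInt_eq_zero {x : ℝ} (hx : x ^ 2 = 1) {k : ℕ} (hk : k ≠ 0) :
    legendreInt k x = 0 := by
  obtain ⟨n, rfl⟩ := Nat.exists_eq_succ_of_ne_zero hk
  simp [legendreInt, ultraspherical_neg_half_eq_zero hx n]

/-- The primitive `C_{k+2}^{(-3/2)} / 3` of `legendreInt k`. -/
theorem hasDerivAt_ultraspherical_div_three (k : ℕ) (x : ℝ) :
    HasDerivAt (fun x => ultraspherical (-3 / 2) (k + 2) x / 3) (legendreInt k x) x := by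
  have h := (hasDerivAt_ultraspherical ne_zero_add_neg_three_half x (k + 1)).div_const 3
  refine h.congr_deriv ?_
  simp only [legendreInt]
  rw [show (-3 / 2 + 1 : ℝ) = -1 / 2 by norm_num]
  ring

theorem ultraspherical_neg_three_half_eq_zero {x : ℝ} (hx : x ^ 2 = 1) : ∀ n,
    ultraspherical (-3 / 2) (n + 4) x = 0
  | 0 => by
    simp only [ultraspherical]
    push_cast
    grind
  | 1 => by
    simp only [ultraspherical]
    push_cast
    grind
  | n + 2 => by
    rw [ultraspherical, ultraspherical_neg_three_half_eq_zero hx (n + 1),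
      ultraspherical_neg_three_half_eq_zero hx n]
    simp

/-- The Kronecker terms are the values at 1 of the primitive `C_{k+2}^{(-3/2)}/3`: they are `1`,
`-1/3`, and `0` from `k = 2` on. -/
theorem integral_legendreInt (k : ℕ) (x : ℝ) :
    ∫ s in x..1, legendreInt k s =
      -(ultraspherical (-3 / 2) (k + 2) x / 3 - (if k = 0 then 1 else 0)
        + (if k = 1 then 1 / 3 else 0)) := by
  rw [intervalIntegral.integral_eq_sub_of_hasDerivAt
    (fun s _ => hasDerivAt_ultraspherical_div_three k s)
    ((continuous_legendreInt k).intervalIntegrable _ _)]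
  rcases k with _ | _ | k
  · simp [ultraspherical]; ring
  · simp [ultraspherical]; ring
  · have := ultraspherical_neg_three_half_eq_zero (x := 1) (by norm_num) k
    simp [this]

theorem integral_legendreInt_full (k : ℕ) :
    ∫ s in (-1 : ℝ)..1, legendreInt k s = -(if k = 1 then 2 / 3 else 0) := by
  rw [integral_legendreInt]
  rcases k with _ | _ | k
  · simp [ultraspherical]; norm_num
  · simp [ultraspherical]; norm_num
  · have := ultraspherical_neg_three_half_eq_zero (x := -1) (by norm_num) k
    simp [this]

/-! ### Integrability of the logarithm and of the Cauchy kernel -/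

theorem intervalIntegrable_abs_rpow_neg_half (c a b : ℝ) :
    IntervalIntegrable (fun s : ℝ => |c - s| ^ (-(1 / 2) : ℝ)) volume a b := by
  have h (a b : ℝ) : IntervalIntegrable (fun s : ℝ => |s| ^ (-(1 / 2) : ℝ)) volume a b := by
    have h0 (x : ℝ) (hx : 0 < x) :
        IntervalIntegrable (fun s : ℝ => |s| ^ (-(1 / 2) : ℝ)) volume 0 x := by
      refine (intervalIntegral.intervalIntegrable_rpow' (a := 0) (b := x)
        (by norm_num : (-1 : ℝ) < -(1 / 2))).congr fun s hs => ?_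
      rw [Set.uIoc_of_le hx.le] at hs
      simp only [abs_of_pos hs.1]
    exact intervalIntegrable_of_even (f := fun s : ℝ => |s| ^ (-(1 / 2) : ℝ))
      (fun x => by simp) h0 (a := a) (b := b)
  have := (h (c - a) (c - b)).comp_sub_left c
  simpa using this

/-- With `ρ` the real or imaginary distance to the singularity, this gives an integrable majorant
depending on one coordinate, plus a continuous function. -/
theorem norm_log_le {w : ℂ} {ρ : ℝ} (hρ : 0 < ρ) (h : ρ ≤ ‖w‖) :
    ‖Complex.log w‖ ≤ Real.pi + ‖w‖ + 2 * ρ ^ (-(1 / 2) : ℝ) := by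
  have hw : 0 < ‖w‖ := hρ.trans_le h
  have h1 : ‖Complex.log w‖ ≤ |Real.log ‖w‖| + |Complex.arg w| := by
    simpa [Complex.log_re, Complex.log_im] using Complex.norm_le_abs_re_add_abs_im (Complex.log w)
  have h2 := Complex.abs_arg_le_pi w
  have h3 : Real.log ‖w‖ ≤ ‖w‖ := (Real.log_le_sub_one_of_pos hw).trans (by linarith)
  have h4 : -Real.log ‖w‖ ≤ 2 * ρ ^ (-(1 / 2) : ℝ) := by
    have := Real.log_le_rpow_div (inv_nonneg.2 hρ.le) (by norm_num : (0 : ℝ) < 1 / 2)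
    rw [Real.log_inv, Real.inv_rpow hρ.le, ← Real.rpow_neg hρ.le] at this
    have := Real.log_le_log hρ h
    linarith
  have h5 : 0 ≤ ρ ^ (-(1 / 2) : ℝ) := by positivity
  have h6 : |Real.log ‖w‖| ≤ ‖w‖ + 2 * ρ ^ (-(1 / 2) : ℝ) := abs_le.2 ⟨by linarith, by linarith⟩
  linarith

/-- Splitting `‖w‖⁻¹` into two square roots and bounding one by each coordinate gives a product of
integrable one-variable functions, so no polar coordinates are needed. -/
theorem norm_inv_le {w : ℂ} (hre : w.re ≠ 0) (him : w.im ≠ 0) :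
    ‖w⁻¹‖ ≤ |w.re| ^ (-(1 / 2) : ℝ) * |w.im| ^ (-(1 / 2) : ℝ) := by
  have hr := abs_pos.2 hre
  have hi := abs_pos.2 him
  have hw : 0 < ‖w‖ := hr.trans_le (Complex.abs_re_le_norm w)
  have h : ‖w‖⁻¹ = ‖w‖ ^ (-(1 / 2) : ℝ) * ‖w‖ ^ (-(1 / 2) : ℝ) := by
    rw [← Real.rpow_add hw, ← Real.rpow_neg_one]
    norm_num
  rw [norm_inv, h]
  gcongr ?_ * ?_
  · exact Real.rpow_le_rpow_of_nonpos hr (Complex.abs_re_le_norm w) (by norm_num)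
  · exact Real.rpow_le_rpow_of_nonpos hi (Complex.abs_im_le_norm w) (by norm_num)

theorem ae_sub_ne_zero (c : ℝ) : ∀ᵐ s : ℝ, c - s ≠ 0 := by
  filter_upwards [Measure.ae_ne volume c] with s hs
  exact sub_ne_zero.2 hs.symm

theorem intervalIntegrable_log_comp {w : ℝ → ℂ} (hw : Continuous w) (c a b : ℝ)
    (h : ∀ s, |c - s| ≤ ‖w s‖) :
    IntervalIntegrable (fun s => Complex.log (w s)) volume a b := by
  have hm : IntervalIntegrable (fun s => Real.pi + ‖w s‖ + 2 * |c - s| ^ (-(1 / 2) : ℝ))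
      volume a b :=
    ((continuous_const.add hw.norm).intervalIntegrable a b).add
      ((intervalIntegrable_abs_rpow_neg_half c a b).const_mul 2)
  refine hm.mono_fun (Complex.measurable_log.comp hw.measurable).aestronglyMeasurable ?_
  filter_upwards [ae_restrict_of_ae (ae_sub_ne_zero c)] with s hs
  exact (norm_log_le (abs_pos.2 hs) (h s)).trans (le_abs_self _)

theorem intervalIntegrable_log_sub (z : ℂ) (a b : ℝ) :
    IntervalIntegrable (fun s : ℝ => Complex.log (z - (s : ℂ))) volume a b :=
  intervalIntegrable_log_comp (by fun_prop) z.re a b fun s => by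
    simpa using Complex.abs_re_le_norm (z - (s : ℂ))

theorem intervalIntegrable_log_sub_I_mul (z : ℂ) (a b : ℝ) :
    IntervalIntegrable (fun t : ℝ => Complex.log (z - Complex.I * (t : ℂ))) volume a b :=
  intervalIntegrable_log_comp (by fun_prop) z.im a b fun s => by
    simpa using Complex.abs_im_le_norm (z - Complex.I * (s : ℂ))

theorem isCompact_square : IsCompact square := isCompact_Icc.prod isCompact_Icc

theorem integrableOn_square_mul {f g : ℝ → ℝ}
    (hf : IntervalIntegrable f volume (-1) 1) (hg : IntervalIntegrable g volume (-1) 1) :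
    IntegrableOn (fun p : ℝ × ℝ => f p.1 * g p.2) square := by
  rw [intervalIntegrable_iff_integrableOn_Icc_of_le (by norm_num)] at hf hg
  rw [IntegrableOn, square, Measure.volume_eq_prod, ← Measure.prod_restrict]
  exact hf.mul_prod hg

theorem ae_square_fst {P : ℝ → Prop} (h : ∀ᵐ s : ℝ, P s) :
    ∀ᵐ p ∂(volume.restrict square), P p.1 :=
  ae_restrict_of_ae (Measure.quasiMeasurePreserving_fst.ae h)

theorem ae_square_snd {P : ℝ → Prop} (h : ∀ᵐ s : ℝ, P s) :
    ∀ᵐ p ∂(volume.restrict square), P p.2 :=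
  ae_restrict_of_ae (Measure.quasiMeasurePreserving_snd.ae h)

theorem integrableOn_log_square (z : ℂ) :
    IntegrableOn (fun p : ℝ × ℝ => Complex.log (z - ((p.1 : ℂ) + Complex.I * (p.2 : ℂ))))
      square := by
  have hc : Continuous fun p : ℝ × ℝ => z - ((p.1 : ℂ) + Complex.I * (p.2 : ℂ)) := by fun_prop
  have h1 : IntegrableOn (fun p : ℝ × ℝ => Real.pi + ‖z - ((p.1 : ℂ) + Complex.I * (p.2 : ℂ))‖)
      square := (continuous_const.add hc.norm).continuousOn.integrableOn_compact isCompact_square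
  have h2 := integrableOn_square_mul
    ((intervalIntegrable_abs_rpow_neg_half z.re (-1) 1).const_mul 2)
    (intervalIntegrable_const (c := (1 : ℝ)))
  refine Integrable.mono (Integrable.add h1 h2)
    (Complex.measurable_log.comp hc.measurable).aestronglyMeasurable ?_
  filter_upwards [ae_square_fst (ae_sub_ne_zero z.re)] with p hp
  refine (norm_log_le (abs_pos.2 hp) ?_).trans ((le_of_eq ?_).trans (le_abs_self _))
  · simpa using Complex.abs_re_le_norm (z - ((p.1 : ℂ) + Complex.I * (p.2 : ℂ)))
  · simp

theorem integrableOn_inv_square (z : ℂ) :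
    IntegrableOn (fun p : ℝ × ℝ => (z - ((p.1 : ℂ) + Complex.I * (p.2 : ℂ)))⁻¹) square := by
  have hc : Continuous fun p : ℝ × ℝ => z - ((p.1 : ℂ) + Complex.I * (p.2 : ℂ)) := by fun_prop
  have h2 := integrableOn_square_mul (intervalIntegrable_abs_rpow_neg_half z.re (-1) 1)
    (intervalIntegrable_abs_rpow_neg_half z.im (-1) 1)
  refine Integrable.mono h2 hc.measurable.inv.aestronglyMeasurable ?_
  filter_upwards [ae_square_fst (ae_sub_ne_zero z.re), ae_square_snd (ae_sub_ne_zero z.im)]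
    with p hp hq
  have h := norm_inv_le (w := z - ((p.1 : ℂ) + Complex.I * (p.2 : ℂ))) (by simpa using hp)
    (by simpa using hq)
  refine h.trans ((le_of_eq ?_).trans (le_abs_self _))
  simp

theorem integrableOn_square_mul_continuous {f : ℝ × ℝ → ℂ} (hf : IntegrableOn f square)
    {u v : ℝ → ℝ} (hu : Continuous u) (hv : Continuous v) :
    IntegrableOn (fun p => f p * ((u p.1 : ℂ) * (v p.2 : ℂ))) square :=
  hf.mul_continuousOn (by fun_prop) isCompact_square

theorem integral_square {f : ℝ × ℝ → ℂ} (hf : IntegrableOn f square) :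
    ∫ p in square, f p = ∫ s in (-1 : ℝ)..1, ∫ t in (-1 : ℝ)..1, f (s, t) := by
  simp_rw [intervalIntegral.integral_of_le (by norm_num : (-1 : ℝ) ≤ 1),
    ← integral_Icc_eq_integral_Ioc]
  exact setIntegral_prod f hf

theorem integral_square_symm {f : ℝ × ℝ → ℂ} (hf : IntegrableOn f square) :
    ∫ p in square, f p = ∫ t in (-1 : ℝ)..1, ∫ s in (-1 : ℝ)..1, f (s, t) := by
  simp_rw [intervalIntegral.integral_of_le (by norm_num : (-1 : ℝ) ≤ 1),
    ← integral_Icc_eq_integral_Ioc]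
  rw [IntegrableOn, square, Measure.volume_eq_prod, ← Measure.prod_restrict] at hf
  rw [square, Measure.volume_eq_prod, ← Measure.prod_restrict]
  exact integral_prod_symm f hf

theorem intervalIntegrable_inner {f : ℝ × ℝ → ℂ} (hf : IntegrableOn f square) :
    IntervalIntegrable (fun s => ∫ t in (-1 : ℝ)..1, f (s, t)) volume (-1) 1 := by
  simp_rw [intervalIntegral.integral_of_le (by norm_num : (-1 : ℝ) ≤ 1),
    ← integral_Icc_eq_integral_Ioc]
  rw [intervalIntegrable_iff_integrableOn_Icc_of_le (by norm_num)]
  rw [IntegrableOn, square, Measure.volume_eq_prod, ← Measure.prod_restrict] at hf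
  exact hf.integral_prod_left

theorem intervalIntegrable_inner_symm {f : ℝ × ℝ → ℂ} (hf : IntegrableOn f square) :
    IntervalIntegrable (fun t => ∫ s in (-1 : ℝ)..1, f (s, t)) volume (-1) 1 := by
  simp_rw [intervalIntegral.integral_of_le (by norm_num : (-1 : ℝ) ≤ 1),
    ← integral_Icc_eq_integral_Ioc]
  rw [intervalIntegrable_iff_integrableOn_Icc_of_le (by norm_num)]
  rw [IntegrableOn, square, Measure.volume_eq_prod, ← Measure.prod_restrict] at hf
  exact hf.integral_prod_right

/-! ### Integration by parts -/

theorem integral_log_mul_legendre {c d : ℂ} (h : ∀ u : ℝ, c - d * (u : ℂ) ∈ Complex.slitPlane)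
    (k : ℕ) :
    ∫ u in (-1 : ℝ)..1, Complex.log (c - d * (u : ℂ)) * (legendre k u : ℂ) =
      Complex.log (c - d) * (legendreInt k 1 : ℂ) - Complex.log (c + d) * (legendreInt k (-1) : ℂ)
        + d * ∫ u in (-1 : ℝ)..1, (c - d * (u : ℂ))⁻¹ * (legendreInt k u : ℂ) := by
  have hlog (u : ℝ) : HasDerivAt (fun u : ℝ => Complex.log (c - d * (u : ℂ)))
      (-(d * (c - d * (u : ℂ))⁻¹)) u := by
    have h1 : HasDerivAt (fun u : ℝ => c - d * (u : ℂ)) (-(d * 1)) u :=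
      ((hasDerivAt_id u).ofReal_comp.const_mul d).const_sub c
    refine (h1.clog_real (h u)).congr_deriv ?_
    rw [div_eq_mul_inv]
    ring
  have hq (u : ℝ) : HasDerivAt (fun u : ℝ => (legendreInt k u : ℂ)) (legendre k u : ℂ) u :=
    (hasDerivAt_legendreInt k u).ofReal_comp
  have hi : Continuous fun u : ℝ => (c - d * (u : ℂ))⁻¹ :=
    Continuous.inv₀ (by fun_prop) fun u => Complex.slitPlane_ne_zero (h u)
  have hp := continuous_legendre k
  have := intervalIntegral.integral_mul_deriv_eq_deriv_mul (a := (-1 : ℝ)) (b := 1)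
    (fun u _ => hlog u) (fun u _ => hq u)
    (by apply Continuous.intervalIntegrable; fun_prop)
    (by apply Continuous.intervalIntegrable; fun_prop)
  rw [this]
  simp only [neg_mul, mul_assoc, intervalIntegral.integral_neg,
    intervalIntegral.integral_const_mul]
  push_cast
  ring_nf

/-- The lower limit is `x` clamped to `[-1, 1]`, which treats all positions of the cut at once. -/
theorem integral_ite_lt (f : ℝ → ℂ) (x : ℝ) :
    ∫ s in (-1 : ℝ)..1, (if x < s then f s else 0) = ∫ s in (min 1 (max (-1) x))..1, f s := by
  rw [intervalIntegral.integral_of_le (by norm_num),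
    intervalIntegral.integral_of_le (min_le_left _ _)]
  have h1 : (fun s => if x < s then f s else 0) = (Set.Ioi x).indicator f := by
    ext s; simp [Set.indicator_apply]
  have h2 : Set.Ioc (-1) 1 ∩ Set.Ioi x = Set.Ioc (min 1 (max (-1) x)) 1 := by
    rw [Set.Ioc_inter_Ioi]
    rcases le_total (max (-1) x) 1 with h | h
    · rw [min_eq_right h]
    · rw [min_eq_left h, Set.Ioc_self, Set.Ioc_eq_empty (not_lt.2 h)]
  rw [h1, setIntegral_indicator measurableSet_Ioi, h2]

/-- Here `-w` lies in the right half-plane, where the logarithm is smooth, so the discontinuity is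
isolated in a step function of `w.im`. -/
theorem log_eq_log_neg_of_re_neg {w : ℂ} (hw : w.re < 0) :
    Complex.log w = Complex.log (-w) + Complex.I * Real.pi
      - (if w.im < 0 then 2 * Complex.I * Real.pi else 0) := by
  have hn : (‖-w‖ : ℝ) = ‖w‖ := norm_neg w
  rw [Complex.log, Complex.log, hn]
  split_ifs with h
  · rw [Complex.arg_of_re_neg_of_im_neg hw h,
      Complex.arg_of_re_nonneg (x := -w) (by simpa using hw.le), hn]
    push_cast; ring
  · rw [Complex.arg_of_re_neg_of_im_nonneg hw (not_lt.1 h),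
      Complex.arg_of_re_nonneg (x := -w) (by simpa using hw.le), hn]
    push_cast; ring

/-- Integration by parts along a vertical segment, which the branch cut may cross. -/
theorem integral_log_mul_legendre_vertical {c : ℂ} (hc : c.re ≠ 0) (j : ℕ) :
    ∫ t in (-1 : ℝ)..1, Complex.log (c - Complex.I * (t : ℂ)) * (legendre j t : ℂ) =
      Complex.log (c - Complex.I) * (legendreInt j 1 : ℂ)
        - Complex.log (c + Complex.I) * (legendreInt j (-1) : ℂ)
        + (if c.re < 0 then 2 * Complex.I * Real.pi *
            (if -1 ≤ c.im ∧ c.im < 1 then (legendreInt j c.im : ℂ) else 0) else 0)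
        + Complex.I * ∫ t in (-1 : ℝ)..1, (c - Complex.I * (t : ℂ))⁻¹ * (legendreInt j t : ℂ) := by
  rcases hc.lt_or_gt with hneg | hpos
  · have hs (t : ℝ) : -c - (-Complex.I) * (t : ℂ) ∈ Complex.slitPlane := by
      left; simpa using hneg
    have hp := integral_log_mul_legendre hs j
    have hq (a : ℝ) : ∫ t in a..1, (legendre j t : ℂ) =
        (legendreInt j 1 : ℂ) - (legendreInt j a : ℂ) :=
      intervalIntegral.integral_eq_sub_of_hasDerivAt
        (fun t _ => (hasDerivAt_legendreInt j t).ofReal_comp)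
        ((Complex.continuous_ofReal.comp (continuous_legendre j)).intervalIntegrable _ _)
    have hl (t : ℝ) : Complex.log (c - Complex.I * (t : ℂ)) * (legendre j t : ℂ) =
        Complex.log (-c - (-Complex.I) * (t : ℂ)) * (legendre j t : ℂ)
        + Complex.I * Real.pi * (legendre j t : ℂ)
        - 2 * Complex.I * Real.pi * (if c.im < t then (legendre j t : ℂ) else 0) := by
      rw [log_eq_log_neg_of_re_neg (w := c - Complex.I * (t : ℂ)) (by simpa using hneg)]
      have e : -(c - Complex.I * (t : ℂ)) = -c - (-Complex.I) * (t : ℂ) := by ring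
      rw [e]
      by_cases ht : c.im < t <;> simp [ht] <;> ring
    have hlog : Continuous fun t : ℝ => Complex.log (-c - (-Complex.I) * (t : ℂ)) :=
      Continuous.clog (by fun_prop) hs
    have hleg := continuous_legendre j
    have i1 : IntervalIntegrable (fun t : ℝ =>
        Complex.log (-c - (-Complex.I) * (t : ℂ)) * (legendre j t : ℂ)) volume (-1) 1 := by
      apply Continuous.intervalIntegrable; fun_prop
    have i2 : IntervalIntegrable (fun t : ℝ => Complex.I * Real.pi * (legendre j t : ℂ))
        volume (-1) 1 := by
      apply Continuous.intervalIntegrable; fun_prop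
    have i3 : IntervalIntegrable (fun t : ℝ => 2 * Complex.I * Real.pi *
        (if c.im < t then (legendre j t : ℂ) else 0)) volume (-1) 1 := by
      apply IntervalIntegrable.const_mul
      have i0 : IntervalIntegrable (fun t : ℝ => (legendre j t : ℂ)) volume (-1) 1 := by
        apply Continuous.intervalIntegrable; fun_prop
      rw [intervalIntegrable_iff] at i0 ⊢
      exact i0.indicator (measurableSet_Ioi (a := c.im))
    simp_rw [hl]
    rw [intervalIntegral.integral_sub (i1.add i2) i3, intervalIntegral.integral_add i1 i2, hp,
      intervalIntegral.integral_const_mul, intervalIntegral.integral_const_mul, integral_ite_lt,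
      hq, hq, if_pos hneg, log_eq_log_neg_of_re_neg (w := c - Complex.I) (by simpa using hneg),
      log_eq_log_neg_of_re_neg (w := c + Complex.I) (by simpa using hneg)]
    have e1 : -(c - Complex.I) = -c - -Complex.I := by ring
    have e2 : -(c + Complex.I) = -c + -Complex.I := by ring
    have e3 : ∫ t in (-1 : ℝ)..1, (-c - -Complex.I * (t : ℂ))⁻¹ * (legendreInt j t : ℂ) =
        -∫ t in (-1 : ℝ)..1, (c - Complex.I * (t : ℂ))⁻¹ * (legendreInt j t : ℂ) := by
      rw [← intervalIntegral.integral_neg]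
      congr 1; ext t
      rw [← neg_mul, ← inv_neg]
      ring_nf
    rw [e1, e2, e3]
    have e4 : (c - Complex.I).im < 0 ↔ c.im < 1 := by simp
    have e5 : (c + Complex.I).im < 0 ↔ c.im < -1 := by
      simp only [Complex.add_im, Complex.I_im]; constructor <;> intro h <;> linarith
    simp only [e4, e5]
    -- Cut below the segment, meeting it, or above it. Height `-1` counts as meeting: the endpoint
    -- value there has argument `π`, whereas the interior limit is `-π`. At height `1` the two
    -- agree.
    rcases lt_or_ge c.im (-1) with h | h
    · have h1 : c.im < 1 := by linarith
      rw [max_eq_left h.le, min_eq_right (by norm_num), if_pos h1, if_pos h,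
        if_neg (by intro h'; linarith [h'.1])]
      ring
    · rcases lt_or_ge c.im 1 with h1 | h1
      · rw [max_eq_right h, min_eq_right h1.le, if_pos h1, if_neg (by linarith), if_pos ⟨h, h1⟩]
        ring
      · rw [max_eq_right h, min_eq_left h1, if_neg (by linarith), if_neg (by linarith),
          if_neg (by intro h'; linarith [h'.2])]
        ring
  · have hs (t : ℝ) : c - Complex.I * (t : ℂ) ∈ Complex.slitPlane := by
      left; simpa using hpos
    rw [integral_log_mul_legendre hs, if_neg hpos.not_gt, add_zero]

/-! ### The Sylvester equation in integral form -/

theorem legendreInt_neg_one (k : ℕ) : legendreInt k (-1) = if k = 0 then -1 else 0 := by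
  split_ifs with h
  · rw [h, legendreInt_zero]
  · exact legendreInt_eq_zero (by norm_num) h

theorem legendreInt_one (k : ℕ) : legendreInt k 1 = if k = 0 then 1 else 0 := by
  split_ifs with h
  · rw [h, legendreInt_zero]
  · exact legendreInt_eq_zero (by norm_num) h

/-- The jump of the logarithm across its branch cut, tested with `legendreInt k` and
`legendreInt j`. -/
def cutJump (k j : ℕ) (z : ℂ) : ℂ :=
  2 * Complex.I * Real.pi * (if -1 ≤ z.im ∧ z.im < 1 then (legendreInt j z.im : ℂ) else 0) *
    ∫ s in (min 1 (max (-1) z.re))..1, (legendreInt k s : ℂ)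

/-- The Cauchy kernel tested with `legendreInt k` and `legendreInt j`. -/
def cauchyMoment (k j : ℕ) (z : ℂ) : ℂ :=
  ∫ p in square, (z - ((p.1 : ℂ) + Complex.I * (p.2 : ℂ)))⁻¹ *
    ((legendreInt k p.1 : ℂ) * (legendreInt j p.2 : ℂ))

theorem integral_log_mul_legendreInt_mul_legendre (k j : ℕ) (z : ℂ) :
    ∫ p in square, Complex.log (z - ((p.1 : ℂ) + Complex.I * (p.2 : ℂ))) *
        ((legendreInt k p.1 : ℂ) * (legendre j p.2 : ℂ)) =
      (if j = 0 then
        (∫ s in (-1 : ℝ)..1, Complex.log (z - Complex.I - (s : ℂ)) * (legendreInt k s : ℂ)) +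
        ∫ s in (-1 : ℝ)..1, Complex.log (z + Complex.I - (s : ℂ)) * (legendreInt k s : ℂ) else 0)
      + cutJump k j z + Complex.I * cauchyMoment k j z := by
  have hk := continuous_legendreInt k
  have hlog := integrableOn_square_mul_continuous (integrableOn_log_square z) hk
    (continuous_legendre j)
  have hinv := integrableOn_square_mul_continuous (integrableOn_inv_square z) hk
    (continuous_legendreInt j)
  rw [integral_square hlog, cauchyMoment, integral_square hinv]
  set J : ℂ := if -1 ≤ z.im ∧ z.im < 1 then (legendreInt j z.im : ℂ) else 0 with hJ
  have hkC : Continuous fun s : ℝ => (legendreInt k s : ℂ) := by fun_prop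
  -- Only `s = x` is excluded, where the vertical line passes through the singularity.
  have key : ∀ᵐ s : ℝ, s ∈ Set.uIoc (-1 : ℝ) 1 →
      ∫ t in (-1 : ℝ)..1, Complex.log (z - ((s : ℂ) + Complex.I * (t : ℂ))) *
        ((legendreInt k s : ℂ) * (legendre j t : ℂ)) =
      (if j = 0 then 1 else 0) *
        (Complex.log (z - Complex.I - (s : ℂ)) * (legendreInt k s : ℂ)
          + Complex.log (z + Complex.I - (s : ℂ)) * (legendreInt k s : ℂ))
      + 2 * Complex.I * Real.pi * J * (if z.re < s then (legendreInt k s : ℂ) else 0)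
      + Complex.I * ∫ t in (-1 : ℝ)..1, (z - ((s : ℂ) + Complex.I * (t : ℂ)))⁻¹ *
        ((legendreInt k s : ℂ) * (legendreInt j t : ℂ)) := by
    filter_upwards [ae_sub_ne_zero z.re] with s hs _
    have h := integral_log_mul_legendre_vertical (c := z - s) (by simpa using hs) j
    have e1 (t : ℝ) : Complex.log (z - ((s : ℂ) + Complex.I * (t : ℂ))) *
        ((legendreInt k s : ℂ) * (legendre j t : ℂ)) = (legendreInt k s : ℂ) *
        (Complex.log (z - s - Complex.I * (t : ℂ)) * (legendre j t : ℂ)) := by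
      rw [sub_add_eq_sub_sub]; ring
    have e2 (t : ℝ) : (z - ((s : ℂ) + Complex.I * (t : ℂ)))⁻¹ *
        ((legendreInt k s : ℂ) * (legendreInt j t : ℂ)) = (legendreInt k s : ℂ) *
        ((z - s - Complex.I * (t : ℂ))⁻¹ * (legendreInt j t : ℂ)) := by
      rw [sub_add_eq_sub_sub]; ring
    simp_rw [e1, e2, intervalIntegral.integral_const_mul, h]
    have e3 : (z - (s : ℂ)).im = z.im := by simp
    have e4 : (z - (s : ℂ)).re < 0 ↔ z.re < s := by simp
    simp only [e3, e4, ← hJ, legendreInt_one, legendreInt_neg_one]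
    rw [show z - (s : ℂ) - Complex.I = z - Complex.I - s by ring,
      show z - (s : ℂ) + Complex.I = z + Complex.I - s by ring]
    split_ifs <;> push_cast <;> ring
  rw [intervalIntegral.integral_congr_ae key]
  have i1 (w : ℂ) : IntervalIntegrable (fun s : ℝ => Complex.log (w - (s : ℂ)) *
      (legendreInt k s : ℂ)) volume (-1) 1 :=
    (intervalIntegrable_log_sub w _ _).mul_continuousOn hkC.continuousOn
  have i2 : IntervalIntegrable (fun s : ℝ => if z.re < s then (legendreInt k s : ℂ) else 0)
      volume (-1) 1 := by
    have i0 := hkC.intervalIntegrable (μ := volume) (-1) 1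
    rw [intervalIntegrable_iff] at i0 ⊢
    exact i0.indicator (measurableSet_Ioi (a := z.re))
  have i3 := intervalIntegrable_inner hinv
  rw [intervalIntegral.integral_add ((((i1 _).add (i1 _)).const_mul _).add (i2.const_mul _))
      (i3.const_mul _),
    intervalIntegral.integral_add (((i1 _).add (i1 _)).const_mul _) (i2.const_mul _),
    intervalIntegral.integral_const_mul, intervalIntegral.integral_const_mul,
    intervalIntegral.integral_const_mul, intervalIntegral.integral_add (i1 _) (i1 _),
    integral_ite_lt, cutJump, ← hJ]
  split_ifs <;> ring

theorem integral_log_mul_legendre_mul_legendreInt (k j : ℕ) (z : ℂ) :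
    ∫ p in square, Complex.log (z - ((p.1 : ℂ) + Complex.I * (p.2 : ℂ))) *
        ((legendre k p.1 : ℂ) * (legendreInt j p.2 : ℂ)) =
      (if k = 0 then
        (∫ t in (-1 : ℝ)..1,
          Complex.log (z - 1 - Complex.I * (t : ℂ)) * (legendreInt j t : ℂ)) +
        ∫ t in (-1 : ℝ)..1,
          Complex.log (z + 1 - Complex.I * (t : ℂ)) * (legendreInt j t : ℂ) else 0)
      + cauchyMoment k j z := by
  have hj := continuous_legendreInt j
  have hlog := integrableOn_square_mul_continuous (integrableOn_log_square z)
    (continuous_legendre k) hj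
  have hinv := integrableOn_square_mul_continuous (integrableOn_inv_square z)
    (continuous_legendreInt k) hj
  rw [integral_square_symm hlog, cauchyMoment, integral_square_symm hinv]
  have hjC : Continuous fun s : ℝ => (legendreInt j s : ℂ) := by fun_prop
  have key : ∀ᵐ t : ℝ, t ∈ Set.uIoc (-1 : ℝ) 1 →
      ∫ s in (-1 : ℝ)..1, Complex.log (z - ((s : ℂ) + Complex.I * (t : ℂ))) *
        ((legendre k s : ℂ) * (legendreInt j t : ℂ)) =
      (if k = 0 then 1 else 0) *
        (Complex.log (z - 1 - Complex.I * (t : ℂ)) * (legendreInt j t : ℂ)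
          + Complex.log (z + 1 - Complex.I * (t : ℂ)) * (legendreInt j t : ℂ))
      + ∫ s in (-1 : ℝ)..1, (z - ((s : ℂ) + Complex.I * (t : ℂ)))⁻¹ *
        ((legendreInt k s : ℂ) * (legendreInt j t : ℂ)) := by
    -- For `t ≠ y` the imaginary part is constant and nonzero on the horizontal line, so the cut is
    -- never met and no jump appears.
    filter_upwards [ae_sub_ne_zero z.im] with t ht _
    have hs (u : ℝ) : z - Complex.I * t - 1 * (u : ℂ) ∈ Complex.slitPlane := by
      right; simpa using ht
    have h := integral_log_mul_legendre hs k
    have e1 (s : ℝ) : Complex.log (z - ((s : ℂ) + Complex.I * (t : ℂ))) *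
        ((legendre k s : ℂ) * (legendreInt j t : ℂ)) = (legendreInt j t : ℂ) *
        (Complex.log (z - Complex.I * (t : ℂ) - 1 * (s : ℂ)) * (legendre k s : ℂ)) := by
      rw [show z - ((s : ℂ) + Complex.I * (t : ℂ)) = z - Complex.I * (t : ℂ) - 1 * (s : ℂ) by ring]
      ring
    have e2 (s : ℝ) : (z - ((s : ℂ) + Complex.I * (t : ℂ)))⁻¹ *
        ((legendreInt k s : ℂ) * (legendreInt j t : ℂ)) = (legendreInt j t : ℂ) *
        ((z - Complex.I * (t : ℂ) - 1 * (s : ℂ))⁻¹ * (legendreInt k s : ℂ)) := by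
      rw [show z - ((s : ℂ) + Complex.I * (t : ℂ)) = z - Complex.I * (t : ℂ) - 1 * (s : ℂ) by ring]
      ring
    simp_rw [e1, e2, intervalIntegral.integral_const_mul, h]
    simp only [legendreInt_one, legendreInt_neg_one]
    rw [show z - Complex.I * (t : ℂ) - 1 = z - 1 - Complex.I * t by ring,
      show z - Complex.I * (t : ℂ) + 1 = z + 1 - Complex.I * t by ring]
    split_ifs <;> push_cast <;> ring
  rw [intervalIntegral.integral_congr_ae key]
  have i1 (w : ℂ) : IntervalIntegrable (fun t : ℝ => Complex.log (w - Complex.I * (t : ℂ)) *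
      (legendreInt j t : ℂ)) volume (-1) 1 :=
    (intervalIntegrable_log_sub_I_mul w _ _).mul_continuousOn hjC.continuousOn
  rw [intervalIntegral.integral_add (((i1 _).add (i1 _)).const_mul _)
      (intervalIntegrable_inner_symm hinv),
    intervalIntegral.integral_const_mul, intervalIntegral.integral_add (i1 _) (i1 _)]
  split_ifs <;> ring

/-! ### Moments against `legendreInt` in terms of Legendre moments -/

/-- If `u` is the sequence of Legendre moments of a linear functional, then this is its sequence
of moments against `legendreInt`. -/
def momentInt (u : ℕ → ℂ) (k : ℕ) : ℂ := (u (k + 1) - prev u k) / (2 * (k : ℂ) + 1)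

theorem legendreInt_eq_momentInt (k : ℕ) (x : ℝ) :
    (legendreInt k x : ℂ) = momentInt (fun n => (legendre n x : ℂ)) k := by
  rcases k with _ | k
  · simp [momentInt, prev, legendreInt_zero, legendre]
  · simp [momentInt, prev, legendreInt_succ]

theorem integral_mul_momentInt {α : Type*} [MeasurableSpace α] {μ : Measure α} {u : ℕ → α → ℂ}
    (hu : ∀ k, Integrable (u k) μ) (k : ℕ) :
    ∫ x, momentInt (fun n => u n x) k ∂μ = momentInt (fun n => ∫ x, u n x ∂μ) k := by
  rcases k with _ | k
  · simp [momentInt, prev]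
  · simp only [momentInt, prev]
    rw [integral_div, integral_sub (hu _) (hu _)]

theorem mul_momentInt (c : ℂ) (u : ℕ → ℂ) (k : ℕ) :
    c * momentInt u k = momentInt (fun n => c * u n) k := by
  rcases k with _ | k <;> simp only [momentInt, prev] <;> ring

theorem integral_log_mul_legendreInt (k : ℕ) (z : ℂ) :
    ∫ s in (-1 : ℝ)..1, Complex.log (z - (s : ℂ)) * (legendreInt k s : ℂ) =
      momentInt (fun n => L1 n z) k := by
  simp_rw [L1, legendreInt_eq_momentInt, mul_momentInt,
    intervalIntegral.integral_of_le (by norm_num : (-1 : ℝ) ≤ 1)]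
  refine integral_mul_momentInt (fun n => ?_) k
  have := (intervalIntegrable_log_sub z (-1) 1).mul_continuousOn
    (Complex.continuous_ofReal.comp (continuous_legendre n)).continuousOn
  rwa [intervalIntegrable_iff_integrableOn_Ioc_of_le (by norm_num)] at this

theorem integral_log_I_mul_legendreInt (k : ℕ) (z : ℂ) :
    ∫ t in (-1 : ℝ)..1, Complex.log (z - Complex.I * (t : ℂ)) * (legendreInt k t : ℂ) =
      momentInt (fun n => M1 n z) k := by
  simp_rw [M1, legendreInt_eq_momentInt, mul_momentInt,
    intervalIntegral.integral_of_le (by norm_num : (-1 : ℝ) ≤ 1)]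
  refine integral_mul_momentInt (fun n => ?_) k
  have := (intervalIntegrable_log_sub_I_mul z (-1) 1).mul_continuousOn
    (Complex.continuous_ofReal.comp (continuous_legendre n)).continuousOn
  rwa [intervalIntegrable_iff_integrableOn_Ioc_of_le (by norm_num)] at this

theorem integrableOn_logIntegrand (k j : ℕ) (z : ℂ) : IntegrableOn (logIntegrand k j z) square :=
  integrableOn_square_mul_continuous (integrableOn_log_square z) (continuous_legendre k)
    (continuous_legendre j)

theorem momentInt_L_row (k j : ℕ) (z : ℂ) :
    momentInt (fun n => L z n j) k =
      ∫ p in square, Complex.log (z - ((p.1 : ℂ) + Complex.I * (p.2 : ℂ))) *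
        ((legendreInt k p.1 : ℂ) * (legendre j p.2 : ℂ)) := by
  simp only [L, Matrix.of_apply]
  rw [← integral_mul_momentInt (fun n => integrableOn_logIntegrand n j z)]
  congr 1; ext p
  rw [legendreInt_eq_momentInt, mul_comm (momentInt _ _), ← mul_assoc, mul_momentInt]
  congr 1; ext n
  rw [logIntegrand]; ring

theorem momentInt_L_col (k j : ℕ) (z : ℂ) :
    momentInt (fun n => L z k n) j =
      ∫ p in square, Complex.log (z - ((p.1 : ℂ) + Complex.I * (p.2 : ℂ))) *
        ((legendre k p.1 : ℂ) * (legendreInt j p.2 : ℂ)) := by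
  simp only [L, Matrix.of_apply]
  rw [← integral_mul_momentInt (fun n => integrableOn_logIntegrand k n z)]
  congr 1; ext p
  rw [legendreInt_eq_momentInt, ← mul_assoc, mul_momentInt]
  congr 1; ext n
  rw [logIntegrand]; ring

theorem C_apply (k n : ℕ) : C k n =
    if k = n + 1 then -1 / (2 * (k : ℂ) + 1)
    else if n = k + 1 then 1 / (2 * (k : ℂ) + 1)
    else 0 := by
  simp only [C, A, B, Matrix.sub_apply, Matrix.of_apply]
  split_ifs <;> ring

theorem tsum_C_mul (k : ℕ) (u : ℕ → ℂ) : ∑' n, C k n * u n = momentInt u k := by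
  rcases k with _ | k
  · rw [tsum_eq_single 1]
    · simp [C_apply, momentInt, prev]
    · intro n hn
      simp [C_apply, hn]
  · rw [tsum_eq_sum (s := {k, k + 2})]
    · rw [Finset.sum_pair (by omega)]
      simp [C_apply, momentInt, prev]
      ring
    · intro n hn
      simp only [Finset.mem_insert, Finset.mem_singleton, not_or] at hn
      rw [C_apply, if_neg (by omega), if_neg (by omega), zero_mul]

theorem sylvester_apply (z : ℂ) (k j : ℕ) :
    infMul C (L z) k j - Complex.I * infMul (L z) C.transpose k j =
      (if j = 0 then momentInt (fun n => L1 n (z - Complex.I)) k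
        + momentInt (fun n => L1 n (z + Complex.I)) k else 0)
      - Complex.I * (if k = 0 then momentInt (fun n => M1 n (z - 1)) j
        + momentInt (fun n => M1 n (z + 1)) j else 0)
      + cutJump k j z := by
  simp only [infMul, Matrix.of_apply, Matrix.transpose_apply]
  -- After commuting the factors, `L Cᵀ` is row `j` of `C` applied to row `k` of `L`. The Cauchy
  -- moments cancel in the final `ring`.
  simp_rw [mul_comm (L z k _), tsum_C_mul, momentInt_L_row, momentInt_L_col,
    integral_log_mul_legendreInt_mul_legendre, integral_log_mul_legendre_mul_legendreInt,
    integral_log_mul_legendreInt, integral_log_I_mul_legendreInt]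
  ring

/-! ### Comparison with `F` -/

/-- The branch-cut term of `mu`, with the endpoint `-1` included. -/
def cutTerm (j : ℕ) (z : ℂ) : ℂ :=
  if z.re < 0 ∧ -1 ≤ z.im ∧ z.im < 1 then
    2 * Complex.I * Real.pi * z.re * (ultraspherical (-1 / 2) (j + 1) z.im : ℂ)
  else 0

theorem mul_logMinus (w : ℂ) :
    w * logMinus w = w * Complex.log w -
      (if w.im = 0 ∧ w.re < 0 then 2 * Complex.I * Real.pi * w.re else 0) := by
  rw [logMinus]
  split_ifs with h
  · have hw : w = (w.re : ℂ) := Complex.ext rfl (by simpa using h.1)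
    have ha : Complex.arg w = Real.pi := Complex.arg_eq_pi_iff.2 ⟨h.2, h.1⟩
    rw [Complex.log, ha, ← hw]
    ring
  · rw [sub_zero]

/-- Passing from `logMinus` to the principal logarithm costs `2πi x` exactly on the line `y = -1`,
`x < 0`. For `j = 0` this is the missing endpoint of the cut term; for `j ≥ 1` the polynomial
vanishes there. -/
theorem mu_eq (j : ℕ) (z : ℂ) :
    mu j z = (if j = 0 then (z - Complex.I) * Complex.log (z - Complex.I)
        + (z + Complex.I) * Complex.log (z + Complex.I) else 0)
      - (if j = 1 then 2 * Complex.I / 3 else 0) - cutTerm j z := by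
  rw [mu, mul_logMinus, cutTerm]
  have e1 : (z + Complex.I).im = 0 ↔ z.im = -1 := by
    simp only [Complex.add_im, Complex.I_im]; constructor <;> intro h <;> linarith
  have e2 : (z + Complex.I).re = z.re := by simp
  simp only [e1, e2]
  by_cases him : z.im = -1
  · rw [him]
    rcases j with _ | j
    · norm_num [ultraspherical]
      ring
    · simp [ultraspherical_neg_half_eq_zero (x := -1) (by norm_num)]
      split_ifs <;> ring
  · have e3 : (-1 ≤ z.im ∧ z.im < 1) ↔ (-1 < z.im ∧ z.im < 1) := by
      constructor
      · rintro ⟨h1, h2⟩; exact ⟨lt_of_le_of_ne h1 (Ne.symm him), h2⟩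
      · rintro ⟨h1, h2⟩; exact ⟨h1.le, h2⟩
    simp only [e3, him, false_and, if_false, sub_zero]
    rcases j with _ | _ | j <;> simp <;> ring

/-- The terms in `x` that `beta` carries in row 0 offset those of the cut terms: `(x-1) + (x+1) =
2x` to the left of the square, and `x - 1` alone for `-1 ≤ x < 1`, which leaves the constant of
`integral_legendreInt`. -/
theorem beta_add_cutTerm (k j : ℕ) (z : ℂ) :
    beta k j z + (if k = 0 then cutTerm j (z - 1) + cutTerm j (z + 1) else 0) = cutJump k j z := by
  rw [beta, cutJump, intervalIntegral.integral_ofReal]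
  simp only [cutTerm]
  have e1 : (z - 1).re < 0 ↔ z.re < 1 := by simp
  have e2 : (z + 1).re < 0 ↔ z.re < -1 := by
    simp only [Complex.add_re, Complex.one_re]; constructor <;> intro h <;> linarith
  have e3 : (z - 1).im = z.im := by simp
  have e4 : (z + 1).im = z.im := by simp
  simp only [e1, e2, e3, e4]
  by_cases him : -1 ≤ z.im ∧ z.im < 1
  swap
  · simp [him]
  rcases lt_or_ge z.re (-1) with h | h
  · have h1 : z.re < 1 := by linarith
    rw [max_eq_left h.le, min_eq_right (by norm_num), integral_legendreInt_full]
    simp only [him, h, h1, h.not_ge, legendreInt, and_self, false_and, if_true, if_false]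
    rcases k with _ | _ | k <;> simp <;> ring
  · rw [max_eq_right h]
    rcases lt_trichotomy z.re 1 with h1 | h1 | h1
    · rw [min_eq_right h1.le, integral_legendreInt]
      simp only [him, h, h1, h1.le, h.not_gt, legendreInt, and_self, false_and, if_true, if_false]
      rcases k with _ | _ | k <;> simp <;> ring
    · rw [h1]
      rcases k with _ | _ | k
      · norm_num [ultraspherical]
      · norm_num [ultraspherical]
      · simp [ultraspherical_neg_three_half_eq_zero (x := 1) (by norm_num)]
    · rw [min_eq_left h1.le]
      simp [h1.not_gt, h1.not_ge, h.not_gt]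

theorem F1_apply (z : ℂ) (k j : ℕ) :
    F1 z k j = (if k = 0 then Complex.I * (momentInt (fun n => M1 n (z - 1)) j
        + momentInt (fun n => M1 n (z + 1)) j) + mu j (z - 1) + mu j (z + 1) else 0)
      + (if k = 1 ∧ j = 0 then -4 / 3 else 0) := by
  simp only [F1, Matrix.of_apply, momentInt]
  by_cases hk : k = 0
  · subst hk
    rcases j with _ | j
    · simp [prev]
    · simp [prev]
      ring
  · simp [hk]

theorem F2_apply (z : ℂ) (k j : ℕ) :
    F2 z k j = (if j = 0 then momentInt (fun n => L1 n (z - Complex.I)) k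
        + momentInt (fun n => L1 n (z + Complex.I)) k
        + lam k (z - Complex.I) + lam k (z + Complex.I) else 0)
      + (if k = 0 ∧ j = 1 then -(4 * Complex.I) / 3 else 0) + beta k j z := by
  simp only [F2, Matrix.of_apply, momentInt]
  by_cases hj : j = 0
  · subst hj
    rcases k with _ | k
    · simp [prev]
    · simp [prev]
      ring
  · by_cases h : k = 0 ∧ j = 1
    · simp [h.1, h.2]
    · simp [hj, h]

theorem sylvester (z : ℂ) :
    infMul C (L z) - Complex.I • infMul (L z) C.transpose = F z := by
  ext k j
  rw [Matrix.sub_apply, Matrix.smul_apply, smul_eq_mul, sylvester_apply, F, Matrix.sub_apply,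
    F1_apply, F2_apply, ← beta_add_cutTerm, mu_eq, mu_eq]
  have e1 : z - Complex.I - 1 = z - 1 - Complex.I := by ring
  have e2 : z - Complex.I + 1 = z + 1 - Complex.I := by ring
  have e3 : z + Complex.I - 1 = z - 1 + Complex.I := by ring
  have e4 : z + Complex.I + 1 = z + 1 + Complex.I := by ring
  simp only [lam, e1, e2, e3, e4]
  -- At `(0,0)` both sides of `F` contribute the same four terms `w log w` with `w = z ± 1 ± i`; at
  -- `(1,0)` and `(0,1)` the constants `-4/3` and `-4i/3` cancel.
  rcases k with _ | _ | k <;> rcases j with _ | _ | j <;> simp <;> ring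

/-! ### The rank bound -/

/-- The row dependence of `beta`. -/
def betaRow (z : ℂ) (k : ℕ) : ℂ :=
  if (-1 ≤ z.re ∧ z.re ≤ 1) ∧ (-1 ≤ z.im ∧ z.im < 1) then
    (ultraspherical (-3 / 2) (k + 2) z.re : ℂ) / 3
      - (if k = 0 then (z.re : ℂ) else 0) + (if k = 1 then 1 / 3 else 0)
  else if z.re < -1 ∧ (-1 ≤ z.im ∧ z.im < 1) then
    -2 * (if k = 0 then (z.re : ℂ) else 0) + (if k = 1 then 2 / 3 else 0)
  else 0

theorem F_succ_col (z : ℂ) (j : ℕ) : ∃ a b : ℂ,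
    (F z).col (j + 1) = a • Pi.single 0 1 + b • betaRow z := by
  -- Away from row 0 such a column is purely `beta`, which factors by definition; the `e_0`
  -- coefficient absorbs the discrepancy in row 0.
  refine ⟨F z 0 (j + 1) - beta 0 (j + 1) z,
    2 * Complex.I * Real.pi * (ultraspherical (-1 / 2) (j + 1 + 1) z.im : ℂ), ?_⟩
  ext k
  have hb (k : ℕ) : beta k (j + 1) z =
      2 * Complex.I * Real.pi * (ultraspherical (-1 / 2) (j + 1 + 1) z.im : ℂ) * betaRow z k := rfl
  simp only [Matrix.col_apply, Pi.add_apply, Pi.smul_apply, smul_eq_mul, ← hb]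
  rcases k with _ | k
  · simp
  · simp [F, F1_apply, F2_apply]

theorem cRank_F_le (z : ℂ) : (F z).cRank ≤ 3 := by
  classical
  have h : Set.range (F z).col ⊆ Submodule.span ℂ
      (({Pi.single 0 1, betaRow z, (F z).col 0} : Finset (ℕ → ℂ)) : Set (ℕ → ℂ)) := by
    rintro _ ⟨j, rfl⟩
    rcases j with _ | j
    · exact Submodule.subset_span (by simp)
    · obtain ⟨a, b, h⟩ := F_succ_col z j
      rw [h]
      exact add_mem (Submodule.smul_mem _ _ (Submodule.subset_span (by simp)))
        (Submodule.smul_mem _ _ (Submodule.subset_span (by simp)))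
  refine (Submodule.rank_mono (Submodule.span_le.2 h)).trans ((rank_span_finset_le _).trans ?_)
  exact_mod_cast Finset.card_le_three

end LogSquare

end

theorem mainTheorem1 :
    -- the explicit form of the tridiagonal matrix `C = A - B`
    (∀ k n : ℕ, LogSquare.C k n =
      if k = n + 1 then -1 / (2 * (k : ℂ) + 1)
      else if n = k + 1 then 1 / (2 * (k : ℂ) + 1)
      else 0) ∧
    ∀ z : ℂ,
      -- the entries of `L(z)` are absolutely convergent integrals
      (∀ k j : ℕ, MeasureTheory.IntegrableOn (LogSquare.logIntegrand k j z) LogSquare.square) ∧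
      -- the Sylvester equation
      LogSquare.infMul LogSquare.C (LogSquare.L z)
          - Complex.I • LogSquare.infMul (LogSquare.L z) LogSquare.C.transpose
        = LogSquare.F z ∧
      -- the rank bound
      (LogSquare.F z).cRank ≤ 3 :=
  ⟨LogSquare.C_apply, fun z => ⟨fun k j => LogSquare.integrableOn_logIntegrand k j z,
    LogSquare.sylvester z, LogSquare.cRank_F_le z⟩⟩
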